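/- \textbf{Theorem (Equilibrium Characterization and Uniqueness).} Let $N\ge 0$ and $\mathcal N=\{1,\dots,2N+1\}$. For each battle $t\in\mathcal N$ let $c_{At},c_{Bt}>0$ be the marginal effort costs of the two matched players and $r_t\in(0,1]$ the discriminatory power, and let $W_A,W_B>0$ be the budgets of managers $A$ and $B$. The managers' game is the following. Manager $i\in\{A,B\}$ simultaneously chooses $\mathbf v_i\in\Delta_i=\{\mathbf v\in\mathbb R^{2N+1}: v_t\ge 0\ \forall t,\ \sum_t v_t=W_i\}$. Team $A$ wins battle $t$ with probability \[ p_{At}(v_{At},v_{Bt})=\frac{(v_{At}/c_{At})^{r_t}}{(v_{At}/c_{At})^{r_t}+(v_{Bt}/c_{Bt})^{r_t}}\quad\text{if }(v_{At},v_{Bt})\ne(0,0),\qquad p_{At}(0,0)=\tfrac12, \] and team $B$ wins it with probability $p_{Bt}=1-p_{At}$, independently across battles. Manager $i$ maximizes the probability that team $i$ wins a majority of the battles, \[ \mathrm{Prob}_i(\mathbf v_A,\mathbf v_B)=\sum_{w\subseteq\mathcal N,\ |w|\ge N+1}\ \prod_{t\in w}p_{it}\prod_{q\in\mathcal N\setminus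 w}p_{jq},\qquad j\ne i . \] Put $k=W_B/W_A$, $c_t=(c_{Bt}/c_{At})^{r_t}$, $p^*_{At}=\frac{c_t}{c_t+k^{r_t}}$, $p^*_{Bt}=\frac{k^{r_t}}{c_t+k^{r_t}}$, \[ \theta^*(t)=\sum_{w\subseteq\mathcal N\setminus\{t\},\ |w|=N}\ \prod_{s\in w}p^*_{As}\prod_{q\in(\mathcal N\setminus\{t\})\setminus w}p^*_{Bq},\qquad S_t=\theta^*(t)\,r_t\,p^*_{At}\,p^*_{Bt}. \] Then the managers' game has a unique pure-strategy Nash equilibrium $(\mathbf v_A^*,\mathbf v_B^*)$ in $\Delta_A\times\Delta_B$, and it is given by \[ v^*_{At}=W_A\,\frac{S_t}{\sum_{\tau}S_\tau},\qquad v^*_{Bt}=W_B\,\frac{S_t}{\sum_{\tau}S_\tau}\qquad\text{for all }t\in\mathcal N . \] In this equilibrium, $p^*_{At}$ and $p^*_{Bt}$ are the probabilities with which teams $A$ and $B$ win battle $t$, and $\theta^*(t)$ is the pivotality of battle $t$, that is, the probability that the other $2N$ battles are split evenly between the teams. -/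

import Mathlib

/-- Primitives of a team contest with `2 * N + 1` battles: marginal effort costs `cA t`, `cB t` of
the two players matched in battle `t`, discriminatory powers `r t` of the Tullock contest success
functions, and the prize budgets `WA`, `WB` of the two managers. -/
structure TeamContest (N : ℕ) where
  cA : Fin (2 * N + 1) → ℝ
  cB : Fin (2 * N + 1) → ℝ
  r : Fin (2 * N + 1) → ℝ
  WA : ℝ
  WB : ℝ

namespace TeamContest

/-- The standing assumptions: positive costs, discriminatory powers in `(0, 1]`, positive budgets. -/
structure Admissible {N : ℕ} (G : TeamContest N) : Prop where
  cA_pos : ∀ t, 0 < G.cA t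
  cB_pos : ∀ t, 0 < G.cB t
  r_pos : ∀ t, 0 < G.r t
  r_le_one : ∀ t, G.r t ≤ 1
  WA_pos : 0 < G.WA
  WB_pos : 0 < G.WB

/-- The strategy space of a manager with budget `W`: all divisions of `W` into nonnegative prizes. -/
def allocations (N : ℕ) (W : ℝ) : Set (Fin (2 * N + 1) → ℝ) :=
  {v | (∀ t, 0 ≤ v t) ∧ ∑ t, v t = W}

/-- Probability that team A wins battle `t` at prizes `x` (team A) and `y` (team B); it is `1 / 2`
if neither player is promised a prize. -/
noncomputable def battleProbA {N : ℕ} (G : TeamContest N) (t : Fin (2 * N + 1)) (x y : ℝ) : ℝ :=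
  open Classical in
  if x = 0 ∧ y = 0 then 1 / 2
  else (x / G.cA t) ^ G.r t / ((x / G.cA t) ^ G.r t + (y / G.cB t) ^ G.r t)

/-- Probability that team B wins battle `t`. -/
noncomputable def battleProbB {N : ℕ} (G : TeamContest N) (t : Fin (2 * N + 1)) (x y : ℝ) : ℝ :=
  1 - G.battleProbA t x y

/-- Probability of winning at least `N + 1` of `2 * N + 1` independent battles, when battle `t` is
won with probability `p t` and lost with probability `q t`: a sum over winning coalitions `w`. -/
noncomputable def majorityProb (N : ℕ) (p q : Fin (2 * N + 1) → ℝ) : ℝ :=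
  ∑ w : Finset (Fin (2 * N + 1)) with N + 1 ≤ w.card, (∏ t ∈ w, p t) * ∏ s ∈ wᶜ, q s

/-- Contest-winning probability of team A: the objective of manager A. -/
noncomputable def probA {N : ℕ} (G : TeamContest N) (vA vB : Fin (2 * N + 1) → ℝ) : ℝ :=
  majorityProb N (fun t => G.battleProbA t (vA t) (vB t)) (fun t => G.battleProbB t (vA t) (vB t))

/-- Contest-winning probability of team B: the objective of manager B. -/
noncomputable def probB {N : ℕ} (G : TeamContest N) (vA vB : Fin (2 * N + 1) → ℝ) : ℝ :=
  majorityProb N (fun t => G.battleProbB t (vA t) (vB t)) (fun t => G.battleProbA t (vA t) (vB t))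

/-- Pure-strategy Nash equilibrium of the managers' game, over the whole (closed) strategy spaces. -/
def IsNash {N : ℕ} (G : TeamContest N) (vA vB : Fin (2 * N + 1) → ℝ) : Prop :=
  vA ∈ allocations N G.WA ∧ vB ∈ allocations N G.WB ∧
    (∀ x ∈ allocations N G.WA, G.probA x vB ≤ G.probA vA vB) ∧
    (∀ y ∈ allocations N G.WB, G.probB vA y ≤ G.probB vA vB)

/-- Pivotality of battle `t`, given battle-winning probabilities `p` (team A) and `q` (team B): the
probability that each team wins `N` of the `2 * N` battles other than `t`. -/
noncomputable def pivotality (N : ℕ) (p q : Fin (2 * N + 1) → ℝ) (t : Fin (2 * N + 1)) : ℝ :=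
  ∑ w ∈ (Finset.univ.erase t).powersetCard N,
    (∏ s ∈ w, p s) * ∏ s ∈ (Finset.univ.erase t) \ w, q s

/-- The budget ratio `k`. -/
noncomputable def budgetRatio {N : ℕ} (G : TeamContest N) : ℝ := G.WB / G.WA

/-- The relative cost advantage `c_t` of team A's player. -/
noncomputable def costRatio {N : ℕ} (G : TeamContest N) (t : Fin (2 * N + 1)) : ℝ :=
  (G.cB t / G.cA t) ^ G.r t

/-- `p*_{At}`. -/
noncomputable def pStarA {N : ℕ} (G : TeamContest N) (t : Fin (2 * N + 1)) : ℝ :=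
  G.costRatio t / (G.costRatio t + G.budgetRatio ^ G.r t)

/-- `p*_{Bt}`. -/
noncomputable def pStarB {N : ℕ} (G : TeamContest N) (t : Fin (2 * N + 1)) : ℝ :=
  G.budgetRatio ^ G.r t / (G.costRatio t + G.budgetRatio ^ G.r t)

/-- `θ*(t)`. -/
noncomputable def pivotalityStar {N : ℕ} (G : TeamContest N) (t : Fin (2 * N + 1)) : ℝ :=
  pivotality N G.pStarA G.pStarB t

/-- Responsiveness `R_t`: discriminatory power times symmetry level. -/
noncomputable def responsiveness {N : ℕ} (G : TeamContest N) (t : Fin (2 * N + 1)) : ℝ :=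
  G.r t * (G.pStarA t * G.pStarB t)

/-- Salience `S_t`: pivotality times responsiveness. -/
noncomputable def salience {N : ℕ} (G : TeamContest N) (t : Fin (2 * N + 1)) : ℝ :=
  G.pivotalityStar t * G.responsiveness t

end TeamContest

/-! In terms of the odds `x t` of winning battle `t`, the majority probability is a sum of
elementary symmetric polynomials divided by `∏ (1 + x t)`, and a telescoping sum reduces its
directional derivative to `marginalWin`, which involves only degree `N`. The analytic core is that
this function is strictly pseudo-concave in the odds (`oddsMajorityProb_lt`): wherever `marginalWin`
vanishes along a line, its derivative is negative (`deriv_marginalWin_neg`). That derivative is the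
Hessian form of the elementary symmetric sum of degree `N + 1` on a tangent direction, minus a
positive definite form. The Hessian form is nonpositive there because elementary symmetric sums are
midpoint log-concave, a consequence of the Marcus–Lopes inequality `elemSum_div_superadditive`. If
manager B's prizes are proportional to salience, Bernoulli's inequality bounds each of A's odds by
its tangent line. The weighted slopes agree across battles exactly because prizes follow salience,
so the budget constraint makes the total first-order change nonpositive. Pseudo-concavity then gives
a unique best response among all allocations (`Admissible.probA_lt`), and exchanging the teams gives
the same for B. Since the game is constant-sum, equilibria are interchangeable, and uniqueness of
best responses yields uniqueness of the equilibrium. -/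

/-! ### Elementary symmetric sums: recursion and Euler's identity. -/

/-- The elementary symmetric sum of degree `k` of the numbers `x i`, `i ∈ A`. -/
noncomputable def elemSum {ι : Type*} (A : Finset ι) (k : ℕ) (x : ι → ℝ) : ℝ :=
  ∑ w ∈ A.powersetCard k, ∏ i ∈ w, x i

/-- The elementary symmetric sum of degree `k - 1`, which is `0` for `k = 0`. -/
noncomputable def elemSumPred {ι : Type*} (A : Finset ι) (k : ℕ) (x : ι → ℝ) : ℝ :=
  match k with
  | 0 => 0
  | k + 1 => elemSum A k x

section ElemSum

variable {ι : Type*}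

@[simp] lemma elemSum_zero (A : Finset ι) (x : ι → ℝ) : elemSum A 0 x = 1 := by
  simp [elemSum]

@[simp] lemma elemSumPred_zero (A : Finset ι) (x : ι → ℝ) : elemSumPred A 0 x = 0 := rfl

@[simp] lemma elemSumPred_succ (A : Finset ι) (k : ℕ) (x : ι → ℝ) :
    elemSumPred A (k + 1) x = elemSum A k x := rfl

lemma elemSum_one (A : Finset ι) (x : ι → ℝ) : elemSum A 1 x = ∑ i ∈ A, x i := by
  simp [elemSum, Finset.powersetCard_one]

lemma elemSum_eq_zero {A : Finset ι} {k : ℕ} (h : A.card < k) (x : ι → ℝ) :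
    elemSum A k x = 0 := by
  simp [elemSum, Finset.powersetCard_eq_empty.2 h]

@[simp] lemma elemSum_empty_succ (k : ℕ) (x : ι → ℝ) : elemSum ∅ (k + 1) x = 0 :=
  elemSum_eq_zero (by simp) x

lemma elemSum_nonneg {x : ι → ℝ} (hx : ∀ i, 0 < x i) (A : Finset ι) (k : ℕ) :
    0 ≤ elemSum A k x :=
  Finset.sum_nonneg fun _ _ => Finset.prod_nonneg fun i _ => (hx i).le

lemma elemSum_pos {x : ι → ℝ} (hx : ∀ i, 0 < x i) {A : Finset ι} {k : ℕ} (h : k ≤ A.card) :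
    0 < elemSum A k x :=
  Finset.sum_pos (fun _ _ => Finset.prod_pos fun i _ => hx i) (Finset.powersetCard_nonempty.2 h)

lemma elemSum_smul (A : Finset ι) (k : ℕ) (c : ℝ) (x : ι → ℝ) :
    elemSum A k (fun i => c * x i) = c ^ k * elemSum A k x := by
  unfold elemSum
  rw [Finset.mul_sum]
  refine Finset.sum_congr rfl fun w hw => ?_
  rw [Finset.prod_mul_distrib, Finset.prod_const, (Finset.mem_powersetCard.1 hw).2]

variable [DecidableEq ι]

lemma elemSum_insert {A : Finset ι} {a : ι} (ha : a ∉ A) (k : ℕ) (x : ι → ℝ) :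
    elemSum (insert a A) k x = x a * elemSumPred A k x + elemSum A k x := by
  cases k with
  | zero => simp
  | succ k =>
    simp only [elemSum, elemSumPred_succ]
    have hmem : ∀ w ∈ A.powersetCard k, a ∉ w := fun w hw h =>
      ha ((Finset.mem_powersetCard.1 hw).1 h)
    rw [Finset.powersetCard_succ_insert ha, Finset.sum_union, Finset.sum_image, Finset.mul_sum,
      add_comm]
    · congr 1
      exact Finset.sum_congr rfl fun w hw => Finset.prod_insert (hmem w hw)
    · intro u hu v hv huv
      rw [← Finset.erase_insert (hmem u hu), ← Finset.erase_insert (hmem v hv)]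
      exact congrArg (fun w => w.erase a) huv
    · rw [Finset.disjoint_left]
      intro w hw hw'
      obtain ⟨u, -, rfl⟩ := Finset.mem_image.1 hw'
      exact ha ((Finset.mem_powersetCard.1 hw).1 (Finset.mem_insert_self a u))

lemma elemSum_erase {A : Finset ι} {a : ι} (ha : a ∈ A) (k : ℕ) (x : ι → ℝ) :
    elemSum A k x = x a * elemSumPred (A.erase a) k x + elemSum (A.erase a) k x := by
  conv_lhs => rw [← Finset.insert_erase ha]
  exact elemSum_insert (Finset.notMem_erase a A) k x

lemma erase_insert_of_mem {A : Finset ι} {a i : ι} (ha : a ∉ A) (hi : i ∈ A) :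
    (insert a A).erase i = insert a (A.erase i) :=
  Finset.erase_insert_of_ne fun h => ha (h ▸ hi)

/-- Euler's identity for elementary symmetric sums. -/
lemma sum_mul_elemSumPred_erase (A : Finset ι) (k : ℕ) (x : ι → ℝ) :
    ∑ i ∈ A, x i * elemSumPred (A.erase i) k x = k * elemSum A k x := by
  induction A using Finset.induction_on generalizing k with
  | empty => cases k <;> simp
  | insert a A ha ih =>
    cases k with
    | zero => simp
    | succ k =>
      rw [Finset.sum_insert ha, Finset.erase_insert ha, elemSum_insert ha]
      have : ∑ i ∈ A, x i * elemSumPred ((insert a A).erase i) (k + 1) x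
          = x a * ∑ i ∈ A, x i * elemSumPred (A.erase i) k x
            + ∑ i ∈ A, x i * elemSumPred (A.erase i) (k + 1) x := by
        rw [Finset.mul_sum, ← Finset.sum_add_distrib]
        refine Finset.sum_congr rfl fun i hi => ?_
        rw [erase_insert_of_mem ha hi, elemSumPred_succ, elemSumPred_succ,
          elemSum_insert (fun h => ha (Finset.mem_of_mem_erase h))]
        ring
      rw [this, ih, ih, elemSumPred_succ]
      push_cast
      ring

/-! ### The Marcus–Lopes inequality and midpoint log-concavity. -/

/-- The parallel sum `a * u / (a + u)` is superadditive, and monotone in `u`. -/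
lemma parallelSum_add_le {a b u v w : ℝ} (ha : 0 < a) (hb : 0 < b) (hu : 0 ≤ u) (hv : 0 ≤ v)
    (hw : u + v ≤ w) :
    a * u / (a + u) + b * v / (b + v) ≤ (a + b) * w / ((a + b) + w) := by
  have h1 : (a + b) * (u + v) / ((a + b) + (u + v)) ≤ (a + b) * w / ((a + b) + w) := by
    rw [div_le_div_iff₀ (by positivity) (by linarith)]
    nlinarith [mul_le_mul_of_nonneg_left hw (by positivity : 0 ≤ (a + b) * (a + b))]
  refine le_trans ?_ h1
  rw [div_add_div _ _ (by positivity) (by positivity),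
    div_le_div_iff₀ (by positivity) (by positivity)]
  -- After clearing denominators, the difference of the two sides is `(a * v - b * u) ^ 2`.
  nlinarith [sq_nonneg (a * v - b * u)]

/-- Euler's identity combined with the one-element recursion writes the ratio as a sum of parallel
sums of `x i` with the ratio one degree lower. This drives the induction on the degree. -/
lemma succ_mul_elemSum_div {x : ι → ℝ} (hx : ∀ i, 0 < x i) {A : Finset ι} {k : ℕ}
    (hk : k + 1 ≤ A.card) :
    ((k + 2 : ℕ) : ℝ) * (elemSum A (k + 2) x / elemSum A (k + 1) x)
      = ∑ i ∈ A, x i * (elemSum (A.erase i) (k + 1) x / elemSum (A.erase i) k x)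
          / (x i + elemSum (A.erase i) (k + 1) x / elemSum (A.erase i) k x) := by
  rw [← mul_div_assoc, ← sum_mul_elemSumPred_erase, Finset.sum_div]
  refine Finset.sum_congr rfl fun i hi => ?_
  have hpos : 0 < elemSum (A.erase i) k x :=
    elemSum_pos hx (by rw [Finset.card_erase_of_mem hi]; omega)
  have hpos' := elemSum_pos hx hk
  rw [elemSum_erase hi] at hpos' ⊢
  simp only [elemSumPred_succ] at hpos' ⊢
  field_simp

/-- The ratio of consecutive elementary symmetric sums is superadditive (Marcus and Lopes). -/
theorem elemSum_div_superadditive {x y : ι → ℝ} (hx : ∀ i, 0 < x i) (hy : ∀ i, 0 < y i) (k : ℕ)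
    (A : Finset ι) :
    elemSum A (k + 1) x / elemSum A k x + elemSum A (k + 1) y / elemSum A k y
      ≤ elemSum A (k + 1) (fun i => x i + y i) / elemSum A k (fun i => x i + y i) := by
  induction k generalizing A with
  | zero => simp [elemSum_one, Finset.sum_add_distrib]
  | succ k ih =>
    rcases lt_or_ge A.card (k + 1) with h | h
    · simp [elemSum_eq_zero (show A.card < k + 1 + 1 by omega)]
    · have hc : (0 : ℝ) < ((k + 2 : ℕ) : ℝ) := by positivity
      refine le_of_mul_le_mul_left ?_ hc
      have hxy : ∀ i, 0 < x i + y i := fun i => add_pos (hx i) (hy i)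
      rw [mul_add, succ_mul_elemSum_div hx h, succ_mul_elemSum_div hy h,
        succ_mul_elemSum_div hxy h, ← Finset.sum_add_distrib]
      exact Finset.sum_le_sum fun i _ => parallelSum_add_le (hx i) (hy i)
        (div_nonneg (elemSum_nonneg hx _ _) (elemSum_nonneg hx _ _))
        (div_nonneg (elemSum_nonneg hy _ _) (elemSum_nonneg hy _ _)) (ih _)

/-- Each elementary symmetric sum is the product of its consecutive ratios. Superadditivity and `4 *
a * b ≤ (a + b) ^ 2` supply one factor 4 per degree. -/
theorem elemSum_mul_le_sq_add {x y : ι → ℝ} (hx : ∀ i, 0 < x i) (hy : ∀ i, 0 < y i) (k : ℕ)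
    (A : Finset ι) :
    4 ^ k * (elemSum A k x * elemSum A k y) ≤ elemSum A k (fun i => x i + y i) ^ 2 := by
  induction k with
  | zero => simp
  | succ k ih =>
    rcases lt_or_ge A.card (k + 1) with h | h
    · simp [elemSum_eq_zero h]
    · have hk : k ≤ A.card := by omega
      have hxy : ∀ i, 0 < x i + y i := fun i => add_pos (hx i) (hy i)
      have key := elemSum_div_superadditive hx hy k A
      have px := elemSum_pos hx hk
      have py := elemSum_pos hy hk
      have pz := elemSum_pos hxy hk
      have ux := div_nonneg (elemSum_nonneg hx A (k + 1)) px.le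
      have uy := div_nonneg (elemSum_nonneg hy A (k + 1)) py.le
      rw [← div_mul_cancel₀ (elemSum A (k + 1) x) px.ne',
        ← div_mul_cancel₀ (elemSum A (k + 1) y) py.ne',
        ← div_mul_cancel₀ (elemSum A (k + 1) fun i => x i + y i) pz.ne', mul_pow]
      set a := elemSum A (k + 1) x / elemSum A k x
      set b := elemSum A (k + 1) y / elemSum A k y
      set c := elemSum A (k + 1) (fun i => x i + y i) / elemSum A k fun i => x i + y i
      have hc : 4 * (a * b) ≤ c ^ 2 := by nlinarith [sq_nonneg (a - b)]
      calc 4 ^ (k + 1) * (a * elemSum A k x * (b * elemSum A k y))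
          = 4 * (a * b) * (4 ^ k * (elemSum A k x * elemSum A k y)) := by ring
        _ ≤ c ^ 2 * elemSum A k (fun i => x i + y i) ^ 2 := by gcongr

lemma elemSum_line_mul_le_sq {x f : ι → ℝ} {s : ℝ} (h₁ : ∀ i, 0 < x i + s * f i)
    (h₂ : ∀ i, 0 < x i + -s * f i) (k : ℕ) (A : Finset ι) :
    elemSum A k (fun i => x i + s * f i) * elemSum A k (fun i => x i + -s * f i)
      ≤ elemSum A k x ^ 2 := by
  have h := elemSum_mul_le_sq_add h₁ h₂ k A
  have e : (fun i => x i + s * f i + (x i + -s * f i)) = fun i => 2 * x i := by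
    funext i; ring
  rw [e, elemSum_smul, mul_pow, ← pow_mul, mul_comm k 2, pow_mul] at h
  norm_num at h
  simpa using h

/-! ### Derivatives along lines and the Hessian on tangent directions. -/

lemma hasDerivAt_elemSum_line (x f : ι → ℝ) (A : Finset ι) (k : ℕ) (s : ℝ) :
    HasDerivAt (fun s : ℝ => elemSum A k (fun i => x i + s * f i))
      (∑ t ∈ A, f t * elemSumPred (A.erase t) k (fun i => x i + s * f i)) s := by
  induction A using Finset.induction_on generalizing k with
  | empty =>
    cases k with
    | zero => simpa using hasDerivAt_const s (1 : ℝ)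
    | succ k => simpa using hasDerivAt_const s (0 : ℝ)
  | insert a A ha ih =>
    cases k with
    | zero => simpa using hasDerivAt_const s (1 : ℝ)
    | succ k =>
      have hl : HasDerivAt (fun s : ℝ => x a + s * f a) (f a) s := by
        simpa using ((hasDerivAt_id s).mul_const (f a)).const_add (x a)
      have h := (hl.fun_mul (ih k)).fun_add (ih (k + 1))
      simp only [elemSum_insert ha, elemSumPred_succ] at h ⊢
      refine h.congr_deriv ?_
      rw [Finset.sum_insert ha, Finset.erase_insert ha, add_assoc, Finset.mul_sum,
        ← Finset.sum_add_distrib]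
      congr 1
      refine Finset.sum_congr rfl fun i hi => ?_
      rw [erase_insert_of_mem ha hi, elemSum_insert (fun h => ha (Finset.mem_of_mem_erase h))]
      ring

/-- A function with vanishing first and positive second derivative at `0` exceeds its value at `0`
at all nearby points. -/
lemma eventually_lt_of_deriv_eq_zero {φ φ' : ℝ → ℝ} {c : ℝ} (hφ : ∀ s, HasDerivAt φ (φ' s) s)
    (hφ' : HasDerivAt φ' c 0) (h0 : φ' 0 = 0) (hc : 0 < c) :
    ∃ ε > 0, ∀ s, 0 < s → s < ε → φ 0 < φ s ∧ φ 0 < φ (-s) := by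
  have hev : ∀ᶠ s in nhdsWithin (0 : ℝ) {0}ᶜ, 0 < slope φ' 0 s :=
    (hasDerivAt_iff_tendsto_slope.1 hφ').eventually (lt_mem_nhds hc)
  rw [eventually_nhdsWithin_iff, Metric.eventually_nhds_iff] at hev
  obtain ⟨ε, hε, H⟩ := hev
  have hs : ∀ s, s ≠ 0 → |s| < ε → 0 < φ' s / s := by
    intro s hs0 hs
    have := H (by simpa [Real.dist_eq] using hs) (by simpa using hs0)
    simpa [slope_def_field, h0] using this
  have hcont : Continuous φ := continuous_iff_continuousAt.2 fun s => (hφ s).continuousAt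
  refine ⟨ε, hε, fun s h1 h2 => ⟨?_, ?_⟩⟩
  · refine strictMonoOn_of_deriv_pos (convex_Icc 0 s) hcont.continuousOn (fun y hy => ?_)
      (Set.left_mem_Icc.2 h1.le) (Set.right_mem_Icc.2 h1.le) h1
    rw [interior_Icc] at hy
    rw [(hφ y).deriv]
    have := hs y hy.1.ne' (by rw [abs_of_pos hy.1]; linarith [hy.2])
    exact (div_pos_iff_of_pos_right hy.1).1 this
  · refine strictAntiOn_of_deriv_neg (convex_Icc (-s) 0) hcont.continuousOn (fun y hy => ?_)
      (Set.left_mem_Icc.2 (by linarith)) (Set.right_mem_Icc.2 (by linarith)) (by linarith)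
    rw [interior_Icc] at hy
    rw [(hφ y).deriv]
    have := hs y hy.2.ne (by rw [abs_of_neg hy.2]; linarith [hy.1])
    by_contra! hcon
    exact absurd this (not_lt.2 (div_nonpos_of_nonneg_of_nonpos hcon hy.2.le))

/-- The Hessian of an elementary symmetric sum is nonpositive on the tangent space of its level
set. -/
theorem elemSum_hessian_nonpos [Fintype ι] {x : ι → ℝ} (hx : ∀ i, 0 < x i) (f : ι → ℝ) (k : ℕ)
    (A : Finset ι) (hA : k + 1 ≤ A.card) (h : ∑ t ∈ A, f t * elemSum (A.erase t) k x = 0) :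
    ∑ t ∈ A, f t * ∑ s ∈ A.erase t, f s * elemSumPred ((A.erase t).erase s) k x ≤ 0 := by
  -- A positive second derivative would make the values at both `s` and `-s` exceed the value at
  -- `0`, contradicting `elemSum_line_mul_le_sq`.
  by_contra! hc
  have h1 := hasDerivAt_elemSum_line x f A (k + 1)
  have h2 : HasDerivAt (fun s : ℝ => ∑ t ∈ A, f t * elemSumPred (A.erase t) (k + 1)
      (fun i => x i + s * f i))
      (∑ t ∈ A, f t * ∑ s ∈ A.erase t, f s * elemSumPred ((A.erase t).erase s) k x) 0 := by
    refine HasDerivAt.fun_sum fun t _ => HasDerivAt.const_mul _ ?_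
    simpa using hasDerivAt_elemSum_line x f (A.erase t) k 0
  obtain ⟨ε, hε, H⟩ := eventually_lt_of_deriv_eq_zero h1 h2 (by simpa using h) hc
  have hev : ∀ᶠ s in nhds (0 : ℝ), ∀ i, 0 < x i + s * f i ∧ 0 < x i + -s * f i := by
    refine Filter.eventually_all.2 fun i => ?_
    have c1 : ContinuousAt (fun s : ℝ => x i + s * f i) 0 := by fun_prop
    have c2 : ContinuousAt (fun s : ℝ => x i + -s * f i) 0 := by fun_prop
    exact (c1.eventually (lt_mem_nhds (by simpa using hx i))).and
      (c2.eventually (lt_mem_nhds (by simpa using hx i)))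
  obtain ⟨δ, hδ, K⟩ := Metric.eventually_nhds_iff.1 hev
  obtain ⟨s, hs0, hs⟩ := exists_between (lt_min hε hδ)
  have hsδ := K (y := s) (by
    rw [Real.dist_eq, sub_zero, abs_of_pos hs0]; exact hs.trans_le (min_le_right _ _))
  have hle := elemSum_line_mul_le_sq (fun i => (hsδ i).1) (fun i => (hsδ i).2) (k + 1) A
  obtain ⟨l1, l2⟩ := H s hs0 (hs.trans_le (min_le_left _ _))
  have hp : 0 < elemSum A (k + 1) x := elemSum_pos hx hA
  simp only [zero_mul, add_zero] at l1 l2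
  nlinarith [mul_lt_mul'' l1 l2 hp.le hp.le]

end ElemSum

/-! ### Sign of the second-order term where the marginal winning probability vanishes. -/

section Majority

variable {ι : Type*} [Fintype ι] [DecidableEq ι]

/-- Up to a positive factor, the derivative in direction `d` of the probability of winning more
than `k` battles, at odds `x`. -/
noncomputable def marginalWin (k : ℕ) (x d : ι → ℝ) : ℝ :=
  ∑ t, d t * (elemSum (Finset.univ.erase t) k x / (1 + x t))

lemma elemSum_eq_sum_ite (A : Finset ι) (k : ℕ) (x : ι → ℝ) :
    elemSum A k x
      = ∑ w ∈ Finset.univ.powersetCard k, if w ⊆ A then ∏ i ∈ w, x i else 0 := by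
  rw [← Finset.sum_filter, elemSum]
  refine Finset.sum_congr ?_ fun _ _ => rfl
  ext w
  simp [Finset.mem_powersetCard, and_comm]

lemma sum_sum_erase_mul (g : ι → ℝ) :
    ∑ t, ∑ u ∈ Finset.univ.erase t, g t * g u = (∑ t, g t) ^ 2 - ∑ t, g t ^ 2 := by
  rw [sq, Finset.sum_mul_sum, ← Finset.sum_sub_distrib]
  refine Finset.sum_congr rfl fun t _ => ?_
  rw [← Finset.add_sum_erase _ _ (Finset.mem_univ t)]
  ring

/-- Grouped by the `k`-element coalition `w`, the expression is a positive combination of `∑ f t ^ 2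
+ (∑ f t) ^ 2`, both sums over `t ∉ w`. -/
lemma two_mul_sum_add_sum_elemSum_pos {x f : ι → ℝ} (hx : ∀ i, 0 < x i) (hf : f ≠ 0) {k : ℕ}
    (hk : k + 1 ≤ Fintype.card ι) :
    0 < 2 * ∑ t, f t ^ 2 * elemSum (Finset.univ.erase t) k x
      + ∑ t, ∑ u ∈ Finset.univ.erase t,
          f t * f u * elemSum ((Finset.univ.erase t).erase u) k x := by
  have key : 2 * ∑ t, f t ^ 2 * elemSum (Finset.univ.erase t) k x
      + ∑ t, ∑ u ∈ Finset.univ.erase t,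
          f t * f u * elemSum ((Finset.univ.erase t).erase u) k x
      = ∑ w ∈ (Finset.univ : Finset ι).powersetCard k, (∏ i ∈ w, x i) *
        (∑ t, (if t ∈ w then 0 else f t) ^ 2 + (∑ t, if t ∈ w then 0 else f t) ^ 2) := by
    have h1 : ∀ t, f t ^ 2 * elemSum (Finset.univ.erase t) k x
        = ∑ w ∈ (Finset.univ : Finset ι).powersetCard k,
          (∏ i ∈ w, x i) * (if t ∈ w then 0 else f t) ^ 2 := by
      intro t
      rw [elemSum_eq_sum_ite, Finset.mul_sum]
      refine Finset.sum_congr rfl fun w _ => ?_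
      by_cases ht : t ∈ w <;> simp [Finset.subset_erase, ht, mul_comm]
    have h2 : ∀ t, ∀ u ∈ Finset.univ.erase t,
        f t * f u * elemSum ((Finset.univ.erase t).erase u) k x
        = ∑ w ∈ (Finset.univ : Finset ι).powersetCard k,
          (∏ i ∈ w, x i) * ((if t ∈ w then 0 else f t) * (if u ∈ w then 0 else f u)) := by
      intro t u _
      rw [elemSum_eq_sum_ite, Finset.mul_sum]
      refine Finset.sum_congr rfl fun w _ => ?_
      by_cases ht : t ∈ w <;> by_cases hu : u ∈ w <;>
        simp [Finset.subset_erase, ht, hu, mul_comm]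
    rw [Finset.sum_congr rfl fun t _ => h1 t,
      Finset.sum_congr rfl fun t _ => Finset.sum_congr rfl (h2 t),
      Finset.sum_congr rfl fun t _ => Finset.sum_comm, Finset.sum_comm,
      Finset.sum_comm (s := Finset.univ) (t := Finset.univ.powersetCard k), Finset.mul_sum,
      ← Finset.sum_add_distrib]
    refine Finset.sum_congr rfl fun w _ => ?_
    have := sum_sum_erase_mul fun t => if t ∈ w then 0 else f t
    simp only [← Finset.mul_sum] at this ⊢
    rw [this]
    ring
  rw [key]
  have hX : ∀ w : Finset ι, 0 < ∏ i ∈ w, x i := fun w => Finset.prod_pos fun i _ => hx i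
  obtain ⟨t, ht⟩ := Function.ne_iff.1 hf
  -- A coalition avoiding an index with `f t ≠ 0` makes its summand strictly positive.
  obtain ⟨w, hw⟩ := Finset.powersetCard_nonempty (s := Finset.univ.erase t) (n := k).2 (by
    rw [Finset.card_erase_of_mem (Finset.mem_univ t), Finset.card_univ]; omega)
  rw [Finset.mem_powersetCard] at hw
  have htw : t ∉ w := fun h => Finset.notMem_erase t _ (hw.1 h)
  refine Finset.sum_pos' (fun w _ => mul_nonneg (hX w).le (add_nonneg
    (Finset.sum_nonneg fun _ _ => sq_nonneg _) (sq_nonneg _)))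
    ⟨w, Finset.mem_powersetCard.2 ⟨Finset.subset_univ _, hw.2⟩, mul_pos (hX w) ?_⟩
  refine add_pos_of_pos_of_nonneg (Finset.sum_pos' (fun _ _ => sq_nonneg _)
    ⟨t, Finset.mem_univ t, ?_⟩) (sq_nonneg _)
  simpa [htw] using sq_pos_of_ne_zero (by simpa using ht)

lemma hasDerivAt_marginalWin (k : ℕ) (x d : ι → ℝ) (s : ℝ) (hs : ∀ t, 1 + (x t + s * d t) ≠ 0) :
    HasDerivAt (fun s : ℝ => marginalWin k (fun i => x i + s * d i) d)
      (∑ t, d t * (((∑ u ∈ Finset.univ.erase t, d u *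
          elemSumPred ((Finset.univ.erase t).erase u) k (fun i => x i + s * d i))
            * (1 + (x t + s * d t))
          - elemSum (Finset.univ.erase t) k (fun i => x i + s * d i) * d t)
        / (1 + (x t + s * d t)) ^ 2)) s := by
  refine HasDerivAt.fun_sum fun t _ => HasDerivAt.const_mul _ ?_
  refine (hasDerivAt_elemSum_line x d _ k s).fun_div ?_ (hs t)
  simpa using (((hasDerivAt_id s).mul_const (d t)).const_add (x t)).const_add 1

/-- Wherever the marginal winning probability vanishes along a line, it is strictly decreasing. -/
lemma deriv_marginalWin_neg {k : ℕ} (hk : k + 1 ≤ Fintype.card ι) {x d : ι → ℝ}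
    (hx : ∀ i, 0 < x i) (hd : d ≠ 0) (h : marginalWin k x d = 0) :
    ∑ t, d t * (((∑ u ∈ Finset.univ.erase t, d u *
          elemSumPred ((Finset.univ.erase t).erase u) k x) * (1 + x t)
          - elemSum (Finset.univ.erase t) k x * d t) / (1 + x t) ^ 2) < 0 := by
  have hx1 : ∀ t, 1 + x t ≠ 0 := fun t => by linarith [hx t]
  -- Rescaling by `1 + x t` turns the vanishing of `marginalWin` into the tangency condition of the
  -- Hessian lemma.
  obtain ⟨f, rfl⟩ : ∃ f : ι → ℝ, d = fun t => f t * (1 + x t) :=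
    ⟨fun t => d t / (1 + x t), by funext t; rw [div_mul_cancel₀ _ (hx1 t)]⟩
  have hf : f ≠ 0 := by
    rintro rfl
    exact hd (by funext t; simp)
  have hE : ∑ t, f t * elemSum (Finset.univ.erase t) k x = 0 := by
    rw [← h, marginalWin]
    refine Finset.sum_congr rfl fun t _ => ?_
    have := hx1 t
    field_simp
  have hQ := elemSum_hessian_nonpos hx f k Finset.univ (by simpa using hk) hE
  have hP := two_mul_sum_add_sum_elemSum_pos hx hf hk
  refine lt_of_eq_of_lt ?_ (add_neg_of_nonpos_of_neg hQ (neg_lt_zero.2 hP))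
  have hterm : ∀ t, f t * (1 + x t) * (((∑ u ∈ Finset.univ.erase t, f u * (1 + x u) *
          elemSumPred ((Finset.univ.erase t).erase u) k x) * (1 + x t)
          - elemSum (Finset.univ.erase t) k x * (f t * (1 + x t))) / (1 + x t) ^ 2)
      = f t * ∑ u ∈ Finset.univ.erase t, f u * elemSumPred ((Finset.univ.erase t).erase u) k x
        + (∑ u, f u) * (f t * elemSum (Finset.univ.erase t) k x)
        - 2 * (f t ^ 2 * elemSum (Finset.univ.erase t) k x)
        - ∑ u ∈ Finset.univ.erase t,
            f t * f u * elemSum ((Finset.univ.erase t).erase u) k x := by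
    intro t
    -- The factor `x u` is absorbed by the recursion that removes `u`; the terms carrying the full
    -- sum of `f` later cancel by `hE`.
    have h1 : ∑ u ∈ Finset.univ.erase t, f u * (1 + x u) *
          elemSumPred ((Finset.univ.erase t).erase u) k x
        = ∑ u ∈ Finset.univ.erase t, f u * elemSumPred ((Finset.univ.erase t).erase u) k x
          + (∑ u ∈ Finset.univ.erase t, f u) * elemSum (Finset.univ.erase t) k x
          - ∑ u ∈ Finset.univ.erase t, f u * elemSum ((Finset.univ.erase t).erase u) k x := by
      rw [Finset.sum_mul, ← Finset.sum_add_distrib, ← Finset.sum_sub_distrib]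
      refine Finset.sum_congr rfl fun u hu => ?_
      rw [elemSum_erase hu k x]
      ring
    rw [h1, ← Finset.add_sum_erase _ f (Finset.mem_univ t)]
    simp only [mul_assoc (f t), ← Finset.mul_sum]
    have := hx1 t
    field_simp
    ring
  rw [Finset.sum_congr rfl fun t _ => hterm t]
  simp only [Finset.sum_sub_distrib, Finset.sum_add_distrib, ← Finset.mul_sum, hE]
  ring

end Majority

/-! ### Majority probability in terms of odds. -/

/-- The generating weight of all coalitions of more than `N` out of `2 * N + 1` battles. -/
noncomputable def majoritySum (N : ℕ) (x : Fin (2 * N + 1) → ℝ) : ℝ :=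
  ∑ i ∈ Finset.range (N + 1), elemSum Finset.univ (N + 1 + i) x

/-- The probability of winning a majority of the battles when battle `t` is won at odds `x t`. -/
noncomputable def oddsMajorityProb (N : ℕ) (x : Fin (2 * N + 1) → ℝ) : ℝ :=
  majoritySum N x / ∏ t, (1 + x t)

lemma prod_div_mul_prod_div {ι : Type*} [DecidableEq ι] {A w : Finset ι} (hw : w ⊆ A)
    (x : ι → ℝ) :
    (∏ t ∈ w, x t / (1 + x t)) * ∏ s ∈ A \ w, 1 / (1 + x s)
      = (∏ t ∈ w, x t) / ∏ t ∈ A, (1 + x t) := by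
  rw [Finset.prod_div_distrib, Finset.prod_div_distrib, div_mul_div_comm,
    mul_comm (∏ t ∈ w, (1 + x t)), Finset.prod_sdiff hw, Finset.prod_const_one, mul_one]

lemma majorityProb_odds (N : ℕ) (x : Fin (2 * N + 1) → ℝ) :
    TeamContest.majorityProb N (fun t => x t / (1 + x t)) (fun t => 1 / (1 + x t))
      = oddsMajorityProb N x := by
  unfold TeamContest.majorityProb oddsMajorityProb majoritySum
  have h : ∀ w : Finset (Fin (2 * N + 1)),
      (∏ t ∈ w, x t / (1 + x t)) * ∏ s ∈ wᶜ, 1 / (1 + x s)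
        = (∏ t ∈ w, x t) / ∏ t, (1 + x t) := fun w => by
    rw [Finset.compl_eq_univ_sdiff, prod_div_mul_prod_div (Finset.subset_univ w)]
  simp only [h]
  rw [← Finset.sum_div]
  congr 1
  -- Winning coalitions are sorted by their excess over the minimal majority `N + 1`.
  rw [← Finset.sum_fiberwise_of_maps_to (g := fun w => w.card - (N + 1))
    (t := Finset.range (N + 1))]
  · refine Finset.sum_congr rfl fun i _ => ?_
    refine Finset.sum_congr ?_ fun _ _ => rfl
    ext w
    simp only [Finset.mem_filter, Finset.mem_univ, true_and, Finset.mem_powersetCard,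
      Finset.subset_univ]
    omega
  · intro w hw
    have h1 := (Finset.mem_filter.1 hw).2
    have h2 := Finset.card_le_univ w
    rw [Fintype.card_fin] at h2
    rw [Finset.mem_range]
    omega

lemma hasDerivAt_oddsMajorityProb (N : ℕ) (x d : Fin (2 * N + 1) → ℝ) (s : ℝ)
    (hs : ∀ t, 1 + (x t + s * d t) ≠ 0) :
    HasDerivAt (fun s : ℝ => oddsMajorityProb N (fun t => x t + s * d t))
      (marginalWin N (fun t => x t + s * d t) d / ∏ t, (1 + (x t + s * d t))) s := by
  have h1 : HasDerivAt (fun s : ℝ => majoritySum N (fun t => x t + s * d t))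
      (∑ i ∈ Finset.range (N + 1), ∑ t, d t *
        elemSumPred (Finset.univ.erase t) (N + 1 + i) (fun t => x t + s * d t)) s :=
    HasDerivAt.fun_sum fun i _ => hasDerivAt_elemSum_line x d _ _ s
  have h2 : HasDerivAt (fun s : ℝ => ∏ t, (1 + (x t + s * d t)))
      (∑ t, (∏ u ∈ Finset.univ.erase t, (1 + (x u + s * d u))) • d t) s :=
    HasDerivAt.fun_finsetProd fun t _ => by
      simpa using (((hasDerivAt_id s).mul_const (d t)).const_add (x t)).const_add 1
  have hM : ∏ t, (1 + (x t + s * d t)) ≠ 0 := Finset.prod_ne_zero_iff.2 fun t _ => hs t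
  refine (h1.fun_div h2 hM).congr_deriv ?_
  generalize hz : (fun t => x t + s * d t) = z
  have hz' : ∀ t, x t + s * d t = z t := fun t => congrFun hz t
  simp only [hz'] at hs hM ⊢
  have hkey : ∀ t, (∑ i ∈ Finset.range (N + 1), elemSumPred (Finset.univ.erase t) (N + 1 + i) z)
      * (1 + z t) - majoritySum N z = elemSum (Finset.univ.erase t) N z := by
    intro t
    -- The sum telescopes to degree `N` minus degree `2 * N + 1`; the latter vanishes since only `2
    -- * N` battles remain.
    have htel := Finset.sum_range_sub' (fun i => elemSum (Finset.univ.erase t) (N + i) z) (N + 1)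
    rw [elemSum_eq_zero (k := N + (N + 1)) (by
      rw [Finset.card_erase_of_mem (Finset.mem_univ t), Finset.card_univ, Fintype.card_fin]
      omega), sub_zero, add_zero] at htel
    rw [← htel, majoritySum, Finset.sum_mul, ← Finset.sum_sub_distrib]
    refine Finset.sum_congr rfl fun i _ => ?_
    rw [elemSum_erase (Finset.mem_univ t), show N + 1 + i = N + i + 1 by ring, elemSumPred_succ,
      ← add_assoc N i 1]
    ring
  have hprod : ∀ t, ∏ u ∈ Finset.univ.erase t, (1 + z u) = (∏ u, (1 + z u)) / (1 + z t) := by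
    intro t
    rw [← Finset.mul_prod_erase _ _ (Finset.mem_univ t), mul_div_cancel_left₀ _ (hs t)]
  rw [Finset.sum_comm, marginalWin, Finset.sum_mul, Finset.mul_sum, ← Finset.sum_sub_distrib,
    Finset.sum_div, Finset.sum_div]
  refine Finset.sum_congr rfl fun t _ => ?_
  rw [← hkey t, hprod t, smul_eq_mul, ← Finset.mul_sum]
  have := hs t
  field_simp

/-- The majority probability is strictly pseudo-concave as a function of the odds. -/
theorem oddsMajorityProb_lt {N : ℕ} {x y : Fin (2 * N + 1) → ℝ} (hx : ∀ t, 0 < x t)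
    (hy : ∀ t, 0 ≤ y t) (hne : y ≠ x) (h : marginalWin N x (fun t => y t - x t) ≤ 0) :
    oddsMajorityProb N y < oddsMajorityProb N x := by
  set d : Fin (2 * N + 1) → ℝ := fun t => y t - x t with hd
  have hd0 : d ≠ 0 := fun h0 => hne (funext fun t => sub_eq_zero.1 (congrFun h0 t))
  -- The endpoint `y` may have zero odds, so strict positivity holds only before `s = 1`.
  have hpos : ∀ s ∈ Set.Ico (0 : ℝ) 1, ∀ t, 0 < x t + s * d t := by
    intro s hs t
    have : x t + s * d t = (1 - s) * x t + s * y t := by simp only [hd]; ring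
    rw [this]
    exact add_pos_of_pos_of_nonneg (mul_pos (by linarith [hs.2]) (hx t)) (mul_nonneg hs.1 (hy t))
  have hpos1 : ∀ s ∈ Set.Icc (0 : ℝ) 1, ∀ t, 0 < 1 + (x t + s * d t) := by
    intro s hs t
    have : x t + s * d t = (1 - s) * x t + s * y t := by simp only [hd]; ring
    rw [this]
    have h1 := mul_nonneg (sub_nonneg.2 hs.2) (hx t).le
    have h2 := mul_nonneg hs.1 (hy t)
    linarith
  have hψ := fun s hs => hasDerivAt_marginalWin N x d s fun t => (hpos1 s hs t).ne'
  have hneg := fun s hs h0 => deriv_marginalWin_neg (k := N) (by rw [Fintype.card_fin]; omega)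
    (hpos s hs) hd0 h0
  -- The marginal starts nonpositive and has negative derivative at each zero before `s = 1`, so it
  -- cannot cross zero upwards.
  have hle : ∀ s ∈ Set.Icc (0 : ℝ) 1, marginalWin N (fun i => x i + s * d i) d ≤ 0 :=
    fun s hs => image_le_of_deriv_right_lt_deriv_boundary (B := fun _ => 0) (B' := fun _ => 0)
      (fun s hs => (hψ s hs).continuousAt.continuousWithinAt)
      (fun s hs => (hψ s (Set.Ico_subset_Icc_self hs)).hasDerivWithinAt) (by simpa using h)
      (fun s => hasDerivAt_const s 0) (fun s hs h0 => hneg s hs h0) hs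
  have hlt : ∀ s ∈ Set.Ioo (0 : ℝ) 1, marginalWin N (fun i => x i + s * d i) d < 0 := by
    intro s hs
    -- An interior zero would be a local maximum, forcing a zero derivative there.
    refine (hle s (Set.Ioo_subset_Icc_self hs)).lt_of_ne fun h0 => ?_
    refine (hneg s (Set.Ioo_subset_Ico_self hs) h0).ne
      (IsLocalMax.hasDerivAt_eq_zero ?_ (hψ s (Set.Ioo_subset_Icc_self hs)))
    filter_upwards [Icc_mem_nhds hs.1 hs.2] with u hu
    rw [h0]
    exact hle u hu
  have hφ := fun s hs => hasDerivAt_oddsMajorityProb N x d s fun t => (hpos1 s hs t).ne'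
  have hanti := strictAntiOn_of_deriv_neg (convex_Icc (0 : ℝ) 1)
    (fun s hs => (hφ s hs).continuousAt.continuousWithinAt) (fun s hs => by
      rw [interior_Icc] at hs
      rw [(hφ s (Set.Ioo_subset_Icc_self hs)).deriv]
      exact div_neg_of_neg_of_pos (hlt s hs)
        (Finset.prod_pos fun t _ => hpos1 s (Set.Ioo_subset_Icc_self hs) t))
  have := hanti (Set.left_mem_Icc.2 zero_le_one) (Set.right_mem_Icc.2 zero_le_one) zero_lt_one
  simpa [hd] using this

/-! ### Complementation identities and salience in terms of odds. -/

namespace TeamContest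

variable {N : ℕ}

lemma pivotality_odds (x : Fin (2 * N + 1) → ℝ) (t : Fin (2 * N + 1)) :
    pivotality N (fun t => x t / (1 + x t)) (fun t => 1 / (1 + x t)) t
      = elemSum (Finset.univ.erase t) N x / ∏ s ∈ Finset.univ.erase t, (1 + x s) := by
  rw [pivotality, elemSum, Finset.sum_div]
  exact Finset.sum_congr rfl fun w hw => prod_div_mul_prod_div (Finset.mem_powersetCard.1 hw).1 x

/-- Among the other `2 * N` battles, the complement of a set of size `N` again has size `N`. -/
lemma pivotality_swap (p q : Fin (2 * N + 1) → ℝ) (t : Fin (2 * N + 1)) :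
    pivotality N q p t = pivotality N p q t := by
  have hcard : ∀ w ∈ (Finset.univ.erase t).powersetCard N,
      Finset.univ.erase t \ w ∈ (Finset.univ.erase t).powersetCard N := by
    intro w hw
    obtain ⟨h1, h2⟩ := Finset.mem_powersetCard.1 hw
    refine Finset.mem_powersetCard.2 ⟨Finset.sdiff_subset, ?_⟩
    rw [Finset.card_sdiff_of_subset h1, Finset.card_erase_of_mem (Finset.mem_univ t),
      Finset.card_univ, Fintype.card_fin, h2]
    omega
  refine Finset.sum_nbij' (fun w => Finset.univ.erase t \ w) (fun w => Finset.univ.erase t \ w)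
    hcard hcard (fun w hw => ?_) (fun w hw => ?_) fun w hw => ?_
  · exact Finset.sdiff_sdiff_eq_self (Finset.mem_powersetCard.1 hw).1
  · exact Finset.sdiff_sdiff_eq_self (Finset.mem_powersetCard.1 hw).1
  · rw [Finset.sdiff_sdiff_eq_self (Finset.mem_powersetCard.1 hw).1, mul_comm]

/-- The number of battles is odd, so exactly one of `w` and `wᶜ` is a majority; the full sum then
expands `∏ (p t + q t) = 1`. -/
lemma majorityProb_add_swap (p q : Fin (2 * N + 1) → ℝ) (h : ∀ t, p t + q t = 1) :
    majorityProb N p q + majorityProb N q p = 1 := by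
  have h1 : majorityProb N q p
      = ∑ w : Finset (Fin (2 * N + 1)) with ¬ N + 1 ≤ w.card, (∏ t ∈ w, p t) * ∏ s ∈ wᶜ, q s := by
    have hc : ∀ w : Finset (Fin (2 * N + 1)), w.card + wᶜ.card = 2 * N + 1 := fun w => by
      rw [Finset.card_add_card_compl, Fintype.card_fin]
    refine Finset.sum_nbij' (fun w => wᶜ) (fun w => wᶜ) (fun w hw => ?_) (fun w hw => ?_)
      (fun w _ => compl_compl w) (fun w _ => compl_compl w) fun w _ => ?_
    · simp only [Finset.mem_filter, Finset.mem_univ, true_and] at hw ⊢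
      have := hc w
      omega
    · simp only [Finset.mem_filter, Finset.mem_univ, true_and] at hw ⊢
      have := hc w
      omega
    · rw [compl_compl, mul_comm]
  rw [h1, majorityProb, Finset.sum_filter_add_sum_filter_not]
  have := Finset.prod_add p q Finset.univ
  simp only [h, Finset.prod_const_one, Finset.powerset_univ] at this
  rw [this]
  simp only [Finset.compl_eq_univ_sdiff]

lemma probA_add_probB (G : TeamContest N) (vA vB : Fin (2 * N + 1) → ℝ) :
    G.probA vA vB + G.probB vA vB = 1 :=
  majorityProb_add_swap _ _ fun _ => add_sub_cancel _ _

/-- The odds at which team A wins battle `t` when prizes are proportional to budgets. -/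
noncomputable def oddsStar (G : TeamContest N) (t : Fin (2 * N + 1)) : ℝ :=
  G.costRatio t / G.budgetRatio ^ G.r t

/-- The equilibrium prize of battle `t`, as a share of the budget. -/
noncomputable def salienceShare (G : TeamContest N) (t : Fin (2 * N + 1)) : ℝ :=
  G.salience t / ∑ τ, G.salience τ

/-- The contest with the roles of the two teams exchanged. -/
def swap (G : TeamContest N) : TeamContest N :=
  ⟨G.cB, G.cA, G.r, G.WB, G.WA⟩

lemma Admissible.swap {G : TeamContest N} (hG : G.Admissible) : G.swap.Admissible :=
  ⟨hG.cB_pos, hG.cA_pos, hG.r_pos, hG.r_le_one, hG.WB_pos, hG.WA_pos⟩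

lemma Admissible.budgetRatio_pos {G : TeamContest N} (hG : G.Admissible) : 0 < G.budgetRatio :=
  div_pos hG.WB_pos hG.WA_pos

lemma Admissible.costRatio_pos {G : TeamContest N} (hG : G.Admissible) (t : Fin (2 * N + 1)) :
    0 < G.costRatio t :=
  Real.rpow_pos_of_pos (div_pos (hG.cB_pos t) (hG.cA_pos t)) _

lemma Admissible.oddsStar_pos {G : TeamContest N} (hG : G.Admissible) (t : Fin (2 * N + 1)) :
    0 < G.oddsStar t :=
  div_pos (hG.costRatio_pos t) (Real.rpow_pos_of_pos hG.budgetRatio_pos _)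

lemma Admissible.pStarA_eq {G : TeamContest N} (hG : G.Admissible) (t : Fin (2 * N + 1)) :
    G.pStarA t = G.oddsStar t / (1 + G.oddsStar t) := by
  have h1 := hG.costRatio_pos t
  have h2 := Real.rpow_pos_of_pos hG.budgetRatio_pos (G.r t)
  unfold pStarA oddsStar
  field_simp
  rw [add_comm]

lemma Admissible.pStarB_eq {G : TeamContest N} (hG : G.Admissible) (t : Fin (2 * N + 1)) :
    G.pStarB t = 1 / (1 + G.oddsStar t) := by
  have h1 := hG.costRatio_pos t
  have h2 := Real.rpow_pos_of_pos hG.budgetRatio_pos (G.r t)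
  unfold pStarB oddsStar
  field_simp
  rw [add_comm]

lemma Admissible.salience_eq {G : TeamContest N} (hG : G.Admissible) (t : Fin (2 * N + 1)) :
    G.salience t = G.r t * (G.oddsStar t *
      (elemSum (Finset.univ.erase t) N G.oddsStar / (1 + G.oddsStar t)))
      / ∏ s, (1 + G.oddsStar s) := by
  have hA : G.pStarA = fun t => G.oddsStar t / (1 + G.oddsStar t) := funext hG.pStarA_eq
  have hB : G.pStarB = fun t => 1 / (1 + G.oddsStar t) := funext hG.pStarB_eq
  have h1 : ∀ s, 0 < 1 + G.oddsStar s := fun s => by linarith [hG.oddsStar_pos s]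
  have h2 : 0 < ∏ s ∈ Finset.univ.erase t, (1 + G.oddsStar s) :=
    Finset.prod_pos fun s _ => h1 s
  have h3 := h1 t
  rw [salience, responsiveness, pivotalityStar, hA, hB, pivotality_odds,
    ← Finset.mul_prod_erase _ _ (Finset.mem_univ t)]
  field_simp

lemma Admissible.salience_pos {G : TeamContest N} (hG : G.Admissible) (t : Fin (2 * N + 1)) :
    0 < G.salience t := by
  rw [hG.salience_eq]
  have h1 : ∀ s, 0 < 1 + G.oddsStar s := fun s => by linarith [hG.oddsStar_pos s]
  have h2 : 0 < elemSum (Finset.univ.erase t) N G.oddsStar := elemSum_pos hG.oddsStar_pos (by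
    rw [Finset.card_erase_of_mem (Finset.mem_univ t), Finset.card_univ, Fintype.card_fin]
    omega)
  exact div_pos (mul_pos (hG.r_pos t) (mul_pos (hG.oddsStar_pos t) (div_pos h2 (h1 t))))
    (Finset.prod_pos fun s _ => h1 s)

lemma Admissible.sum_salience_pos {G : TeamContest N} (hG : G.Admissible) :
    0 < ∑ τ, G.salience τ :=
  Finset.sum_pos (fun τ _ => hG.salience_pos τ) Finset.univ_nonempty

lemma Admissible.salienceShare_pos {G : TeamContest N} (hG : G.Admissible)
    (t : Fin (2 * N + 1)) : 0 < G.salienceShare t :=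
  div_pos (hG.salience_pos t) hG.sum_salience_pos

lemma Admissible.sum_salienceShare {G : TeamContest N} (hG : G.Admissible) :
    ∑ t, G.salienceShare t = 1 := by
  unfold salienceShare
  rw [← Finset.sum_div, div_self hG.sum_salience_pos.ne']

lemma Admissible.smul_salienceShare_mem {G : TeamContest N} (hG : G.Admissible) {W : ℝ}
    (hW : 0 < W) : (fun t => W * G.salienceShare t) ∈ allocations N W :=
  ⟨fun t => (mul_pos hW (hG.salienceShare_pos t)).le, by
    rw [← Finset.mul_sum, hG.sum_salienceShare, mul_one]⟩

/-! ### Best response against prizes proportional to salience. -/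

/-- Team B's prize is positive, so the tie rule never applies, even at `x = 0`. Measuring `x`
relative to A's proportional prize isolates the odds `oddsStar`. -/
lemma Admissible.battleProbA_salienceShare {G : TeamContest N} (hG : G.Admissible)
    {t : Fin (2 * N + 1)} {x : ℝ} (hx : 0 ≤ x) :
    G.battleProbA t x (G.WB * G.salienceShare t)
      = G.oddsStar t * (x / (G.WA * G.salienceShare t)) ^ G.r t
        / (1 + G.oddsStar t * (x / (G.WA * G.salienceShare t)) ^ G.r t) := by
  have hσ := hG.salienceShare_pos t
  have hA := hG.WA_pos
  have hB := hG.WB_pos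
  have cA := hG.cA_pos t
  have cB := hG.cB_pos t
  have hy : 0 < G.WB * G.salienceShare t := mul_pos hB hσ
  have hd : 0 < (G.WB * G.salienceShare t / G.cB t) ^ G.r t :=
    Real.rpow_pos_of_pos (div_pos hy cB) _
  have hz : G.oddsStar t * (x / (G.WA * G.salienceShare t)) ^ G.r t
      = (x / G.cA t) ^ G.r t / (G.WB * G.salienceShare t / G.cB t) ^ G.r t := by
    rw [oddsStar, costRatio, budgetRatio, ← Real.div_rpow (by positivity) (by positivity),
      ← Real.mul_rpow (by positivity) (by positivity),
      ← Real.div_rpow (by positivity) (by positivity)]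
    congr 1
    field_simp
  have hnum : 0 ≤ (x / G.cA t) ^ G.r t := by positivity
  rw [hz, battleProbA, if_neg fun h => hy.ne' h.2]
  field_simp
  rw [add_comm]

lemma Admissible.probA_salienceShare {G : TeamContest N} (hG : G.Admissible)
    {x : Fin (2 * N + 1) → ℝ} (hx : ∀ t, 0 ≤ x t) :
    G.probA x (fun t => G.WB * G.salienceShare t)
      = oddsMajorityProb N fun t =>
          G.oddsStar t * (x t / (G.WA * G.salienceShare t)) ^ G.r t := by
  rw [probA, ← majorityProb_odds]
  simp only [battleProbB, fun t => hG.battleProbA_salienceShare (t := t) (hx t)]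
  congr 1
  funext t
  have h1 := (hG.oddsStar_pos t).le
  have h2 : 0 ≤ x t / (G.WA * G.salienceShare t) :=
    div_nonneg (hx t) (mul_pos hG.WA_pos (hG.salienceShare_pos t)).le
  have h3 : 0 < 1 + G.oddsStar t * (x t / (G.WA * G.salienceShare t)) ^ G.r t := by positivity
  field_simp
  ring

/-- Against prizes proportional to salience, such prizes are the unique best response. -/
theorem Admissible.probA_lt {G : TeamContest N} (hG : G.Admissible) {x : Fin (2 * N + 1) → ℝ}
    (hx : x ∈ allocations N G.WA) (hne : x ≠ fun t => G.WA * G.salienceShare t) :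
    G.probA x (fun t => G.WB * G.salienceShare t)
      < G.probA (fun t => G.WA * G.salienceShare t) (fun t => G.WB * G.salienceShare t) := by
  have hv : ∀ t, 0 < G.WA * G.salienceShare t := fun t =>
    mul_pos hG.WA_pos (hG.salienceShare_pos t)
  have ho := hG.oddsStar_pos
  have hu : ∀ t, 0 ≤ x t / (G.WA * G.salienceShare t) := fun t => div_nonneg (hx.1 t) (hv t).le
  rw [hG.probA_salienceShare hx.1, hG.probA_salienceShare fun t => (hv t).le]
  have hone : (fun t => G.oddsStar t *
      (G.WA * G.salienceShare t / (G.WA * G.salienceShare t)) ^ G.r t) = G.oddsStar := by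
    funext t
    rw [div_self (hv t).ne', Real.one_rpow, mul_one]
  rw [hone]
  refine oddsMajorityProb_lt ho (fun t => mul_nonneg (ho t).le (Real.rpow_nonneg (hu t) _)) ?_ ?_
  · intro h
    refine hne (funext fun t => ?_)
    have h1 : (x t / (G.WA * G.salienceShare t)) ^ G.r t = 1 :=
      mul_left_cancel₀ (ho t).ne' ((congrFun h t).trans (mul_one _).symm)
    rw [← Real.one_rpow (G.r t), Real.rpow_left_inj (hu t) zero_le_one (hG.r_pos t).ne',
      div_eq_one_iff_eq (hv t).ne'] at h1
    exact h1
  · have hM : 0 < ∏ s, (1 + G.oddsStar s) :=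
      Finset.prod_pos fun s _ => by linarith [ho s]
    have hS := hG.sum_salience_pos
    -- The slope on the right does not depend on `t`; this equalization of marginal returns is what
    -- singles out salience.
    have hle : ∀ t, (G.oddsStar t * (x t / (G.WA * G.salienceShare t)) ^ G.r t - G.oddsStar t)
        * (elemSum (Finset.univ.erase t) N G.oddsStar / (1 + G.oddsStar t))
        ≤ (∏ s, (1 + G.oddsStar s)) * ((∑ τ, G.salience τ) / G.WA)
          * (x t - G.WA * G.salienceShare t) := by
      intro t
      -- Bernoulli's inequality, the tangent line of the concave power at 1; here `r t ≤ 1` enters.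
      have hb : (x t / (G.WA * G.salienceShare t)) ^ G.r t
          ≤ 1 + G.r t * (x t / (G.WA * G.salienceShare t) - 1) := by
        have := rpow_one_add_le_one_add_mul_self
          (s := x t / (G.WA * G.salienceShare t) - 1) (by linarith [hu t]) (hG.r_pos t).le
          (hG.r_le_one t)
        rwa [add_sub_cancel] at this
      have hc : 0 ≤ G.oddsStar t *
          (elemSum (Finset.univ.erase t) N G.oddsStar / (1 + G.oddsStar t)) :=
        mul_nonneg (ho t).le (div_nonneg (elemSum_nonneg ho _ _) (by linarith [ho t]))
      have hs : G.r t * (G.oddsStar t *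
          (elemSum (Finset.univ.erase t) N G.oddsStar / (1 + G.oddsStar t)))
          = G.salience t * ∏ s, (1 + G.oddsStar s) := by
        rw [hG.salience_eq t, div_mul_cancel₀ _ hM.ne']
      have hsh : G.salience t = G.salienceShare t * ∑ τ, G.salience τ :=
        (div_mul_cancel₀ _ hS.ne').symm
      calc _ = ((x t / (G.WA * G.salienceShare t)) ^ G.r t - 1) * (G.oddsStar t *
            (elemSum (Finset.univ.erase t) N G.oddsStar / (1 + G.oddsStar t))) := by ring
        _ ≤ (G.r t * (x t / (G.WA * G.salienceShare t) - 1)) * (G.oddsStar t *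
            (elemSum (Finset.univ.erase t) N G.oddsStar / (1 + G.oddsStar t))) :=
          mul_le_mul_of_nonneg_right (by linarith) hc
        _ = (x t / (G.WA * G.salienceShare t) - 1) * (G.salienceShare t * (∑ τ, G.salience τ)
            * ∏ s, (1 + G.oddsStar s)) := by rw [← hsh, ← hs]; ring
        _ = _ := by
          have h1 := hG.salienceShare_pos t
          have h2 := hG.WA_pos
          field_simp
    refine (Finset.sum_le_sum fun t _ => hle t).trans_eq ?_
    -- Both allocations spend the same budget, so the linear bounds sum to zero.
    rw [← Finset.mul_sum, Finset.sum_sub_distrib, hx.2,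
      (hG.smul_salienceShare_mem hG.WA_pos).2, sub_self, mul_zero]

/-! ### Exchanging the teams. -/

lemma Admissible.battleProbB_eq_swap {G : TeamContest N} (hG : G.Admissible)
    (t : Fin (2 * N + 1)) {x y : ℝ} (hx : 0 ≤ x) (hy : 0 ≤ y) :
    G.battleProbB t x y = G.swap.battleProbA t y x := by
  have cA := hG.cA_pos t
  have cB := hG.cB_pos t
  unfold battleProbB battleProbA
  by_cases h : x = 0 ∧ y = 0
  · rw [if_pos h, if_pos h.symm]
    norm_num
  · rw [if_neg h, if_neg fun h' => h h'.symm]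
    have hpos : 0 < (x / G.cA t) ^ G.r t + (y / G.cB t) ^ G.r t := by
      rcases hx.eq_or_lt with rfl | hx
      · have hy' : 0 < y := hy.lt_of_ne fun h0 => h ⟨rfl, h0.symm⟩
        positivity
      · positivity
    simp only [TeamContest.swap]
    rw [add_comm ((y / G.cB t) ^ G.r t), eq_div_iff hpos.ne', sub_mul, div_mul_cancel₀ _ hpos.ne']
    ring

lemma Admissible.probB_eq_swap {G : TeamContest N} (hG : G.Admissible)
    {x y : Fin (2 * N + 1) → ℝ} (hx : ∀ t, 0 ≤ x t) (hy : ∀ t, 0 ≤ y t) :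
    G.probB x y = G.swap.probA y x := by
  have h : ∀ t, G.battleProbA t (x t) (y t) = G.swap.battleProbB t (y t) (x t) := fun t =>
    (hG.swap.battleProbB_eq_swap t (hy t) (hx t)).symm
  simp only [probB, probA, h, fun t => hG.battleProbB_eq_swap t (hx t) (hy t)]

lemma Admissible.oddsStar_swap {G : TeamContest N} (hG : G.Admissible) (t : Fin (2 * N + 1)) :
    G.swap.oddsStar t = (G.oddsStar t)⁻¹ := by
  have cA := hG.cA_pos t
  have cB := hG.cB_pos t
  have hA := hG.WA_pos
  have hB := hG.WB_pos
  simp only [oddsStar, costRatio, budgetRatio, TeamContest.swap]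
  rw [← Real.div_rpow (by positivity) (by positivity),
    ← Real.div_rpow (by positivity) (by positivity), ← Real.inv_rpow (by positivity)]
  congr 1
  field_simp

lemma Admissible.pStarA_swap {G : TeamContest N} (hG : G.Admissible) (t : Fin (2 * N + 1)) :
    G.swap.pStarA t = G.pStarB t := by
  have := hG.oddsStar_pos t
  rw [hG.swap.pStarA_eq, hG.pStarB_eq, hG.oddsStar_swap]
  field_simp
  rw [add_comm]

lemma Admissible.pStarB_swap {G : TeamContest N} (hG : G.Admissible) (t : Fin (2 * N + 1)) :
    G.swap.pStarB t = G.pStarA t :=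
  (hG.swap.pStarA_swap t).symm

/-- The exchange swaps `pStarA` and `pStarB`, and both pivotality and the product of the two are
symmetric in them. -/
lemma Admissible.salience_swap {G : TeamContest N} (hG : G.Admissible) :
    G.swap.salience = G.salience := by
  funext t
  rw [salience, salience, responsiveness, responsiveness, pivotalityStar, pivotalityStar,
    funext hG.pStarA_swap, funext hG.pStarB_swap, pivotality_swap, mul_comm (G.pStarB t)]
  rfl

lemma Admissible.salienceShare_swap {G : TeamContest N} (hG : G.Admissible) :
    G.swap.salienceShare = G.salienceShare := by
  funext t
  rw [salienceShare, salienceShare, hG.salience_swap]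

theorem Admissible.probB_lt {G : TeamContest N} (hG : G.Admissible) {y : Fin (2 * N + 1) → ℝ}
    (hy : y ∈ allocations N G.WB) (hne : y ≠ fun t => G.WB * G.salienceShare t) :
    G.probB (fun t => G.WA * G.salienceShare t) y
      < G.probB (fun t => G.WA * G.salienceShare t) (fun t => G.WB * G.salienceShare t) := by
  have hA : ∀ t, 0 ≤ G.WA * G.salienceShare t := (hG.smul_salienceShare_mem hG.WA_pos).1
  have hB : ∀ t, 0 ≤ G.WB * G.salienceShare t := (hG.smul_salienceShare_mem hG.WB_pos).1
  rw [hG.probB_eq_swap hA hy.1, hG.probB_eq_swap hA hB]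
  have h := hG.swap.probA_lt (x := y) hy
  rw [hG.salienceShare_swap] at h
  exact h hne

/-! ### Existence and uniqueness of the equilibrium. -/

theorem Admissible.isNash_salienceShare {G : TeamContest N} (hG : G.Admissible) :
    G.IsNash (fun t => G.WA * G.salienceShare t) (fun t => G.WB * G.salienceShare t) := by
  refine ⟨hG.smul_salienceShare_mem hG.WA_pos, hG.smul_salienceShare_mem hG.WB_pos,
    fun x hx => ?_, fun y hy => ?_⟩
  · by_cases h : x = fun t => G.WA * G.salienceShare t
    · rw [h]
    · exact (hG.probA_lt hx h).le
  · by_cases h : y = fun t => G.WB * G.salienceShare t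
    · rw [h]
    · exact (hG.probB_lt hy h).le

/-- Equilibria of the constant-sum managers' game are interchangeable, so that the unique best
responses leave room for only one of them. -/
theorem Admissible.eq_of_isNash {G : TeamContest N} (hG : G.Admissible)
    {vA vB : Fin (2 * N + 1) → ℝ} (h : G.IsNash vA vB) :
    vA = (fun t => G.WA * G.salienceShare t) ∧ vB = fun t => G.WB * G.salienceShare t := by
  obtain ⟨hA, hB, hA', hB'⟩ := h
  obtain ⟨mA, mB, nA, nB⟩ := hG.isNash_salienceShare
  have h1 := hA' _ mA
  have h2 := hB' _ mB
  have h3 := nA _ hA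
  have h4 := nB _ hB
  have e1 := G.probA_add_probB vA vB
  have e2 := G.probA_add_probB vA fun t => G.WB * G.salienceShare t
  have e3 := G.probA_add_probB (fun t => G.WA * G.salienceShare t) vB
  have e4 := G.probA_add_probB (fun t => G.WA * G.salienceShare t)
    fun t => G.WB * G.salienceShare t
  constructor
  -- The inequalities form a cycle through the four strategy pairs; a strict best-response
  -- inequality on one edge is contradictory.
  · by_contra hne
    linarith [hG.probA_lt hA hne]
  · by_contra hne
    linarith [hG.probB_lt hB hne]

lemma Admissible.battleProbA_eq_pStarA {G : TeamContest N} (hG : G.Admissible)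
    (t : Fin (2 * N + 1)) :
    G.battleProbA t (G.WA * G.salienceShare t) (G.WB * G.salienceShare t) = G.pStarA t := by
  have hv : 0 < G.WA * G.salienceShare t := mul_pos hG.WA_pos (hG.salienceShare_pos t)
  rw [hG.battleProbA_salienceShare hv.le, div_self hv.ne', Real.one_rpow, mul_one, hG.pStarA_eq]

lemma Admissible.battleProbB_eq_pStarB {G : TeamContest N} (hG : G.Admissible)
    (t : Fin (2 * N + 1)) :
    G.battleProbB t (G.WA * G.salienceShare t) (G.WB * G.salienceShare t) = G.pStarB t := by
  have := hG.oddsStar_pos t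
  rw [battleProbB, hG.battleProbA_eq_pStarA, hG.pStarA_eq, hG.pStarB_eq]
  field_simp
  ring

end TeamContest

theorem mainTheorem1 (N : ℕ) (G : TeamContest N) (hG : G.Admissible) :
    ∃ vA vB : Fin (2 * N + 1) → ℝ,
      G.IsNash vA vB ∧
      (∀ vA' vB' : Fin (2 * N + 1) → ℝ, G.IsNash vA' vB' → vA' = vA ∧ vB' = vB) ∧
      (∀ t, vA t = G.WA * (G.salience t / ∑ τ, G.salience τ)) ∧
      (∀ t, vB t = G.WB * (G.salience t / ∑ τ, G.salience τ)) ∧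
      -- `p*` and `θ*` are the winning probabilities and the pivotality at the equilibrium
      (∀ t, G.battleProbA t (vA t) (vB t) = G.pStarA t) ∧
      (∀ t, G.battleProbB t (vA t) (vB t) = G.pStarB t) ∧
      (∀ t, TeamContest.pivotality N (fun s => G.battleProbA s (vA s) (vB s))
        (fun s => G.battleProbB s (vA s) (vB s)) t = G.pivotalityStar t) := by
  refine ⟨_, _, hG.isNash_salienceShare, fun _ _ h => hG.eq_of_isNash h, fun _ => rfl, fun _ => rfl,
    hG.battleProbA_eq_pStarA, hG.battleProbB_eq_pStarB, fun t => ?_⟩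
  simp only [hG.battleProbA_eq_pStarA, hG.battleProbB_eq_pStarB]
  rfl
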